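/- There is a universal constant $C$ such that the following holds for every integer $n \ge 1$ and every probability space. Let $F_1,\dots,F_n$ be independent random variables taking values in the set of monotone non-decreasing functions from $\mathbb{R}$ to $[0,1]$, where measurability and independence refer to the $\sigma$-algebra generated by the evaluations $f \mapsto f(v)$, $v \in \mathbb{R}$. Let $F_{\mathrm{avg}} = \frac1n (F_1 + \cdots + F_n)$ be their average, let $\mathbb{E} F_{\mathrm{avg}}$ be the function $v \mapsto \mathbb{E}[F_{\mathrm{avg}}(v)]$, and write $\|f\|_\infty = \sup_{v \in \mathbb{R}} |f(v)|$. Then the random variable $\| F_{\mathrm{avg}} - \mathbb{E} F_{\mathrm{avg}} \|_\infty$ is integrable and $$\mathbb{E}\left[ \| F_{\mathrm{avg}} - \mathbb{E} F_{\mathrm{avg}} \|_{\infty} \right] \le C\, n^{-1/2}.$$ In particular $C$ depends neither on $n$ nor on the distributions of $F_1,\dots,F_n$. -/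

import Mathlib

open MeasureTheory ProbabilityTheory

noncomputable section

namespace MonotoneAverage

/-- The sup-norm `sup_v |f v|` of a function `f : ℝ → ℝ` (used for bounded functions only). -/
def supNorm (f : ℝ → ℝ) : ℝ := ⨆ v : ℝ, |f v|

/-- The average `(F₁ + ⋯ + Fₙ) / n` of `n` random functions `ℝ → ℝ`. -/
def avg {Ω : Type*} {n : ℕ} (F : Fin n → Ω → ℝ → ℝ) (ω : Ω) (v : ℝ) : ℝ :=
  (1 / (n : ℝ)) * ∑ i, F i ω v

/-- The pointwise mean `v ↦ 𝔼[G v]` of a random function `G`. -/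
def mean {Ω : Type*} [MeasurableSpace Ω] (P : Measure Ω) (G : Ω → ℝ → ℝ) (v : ℝ) : ℝ :=
  ∫ ω, G ω v ∂P

end MonotoneAverage

end

/-! Randomized signs reduce the problem to a maximal inequality. For fixed signs, the centred sum
splits into two independent centred parts `A` and `B`; Jensen bounds `E‖A‖` and `E‖B‖` by `E‖A -
B‖`, so attaching signs costs only a factor 2 (`integral_norm_sum_le_two_mul`). Averaging over all
signs leaves a deterministic Rademacher bound for each fixed ω.

A monotone function into `[0, 1]` is the integral over levels `t` of the indicators of `t < f v`. At
each level the indices above `t` grow with `v`, so the Rademacher sums form a random walk along a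
chain of index sets. Doob's `L²` inequality bounds its maximum by order `√n`, with no dependence on
the number of points `v` (`sum_norm_signSum_le`). The means are themselves monotone into `[0, 1]`,
so they obey the same bound and no ghost sample is needed.

This gives a bound uniform over finite sets of points. Monotonicity makes one countable set
determine the supremum (`exists_seq_forall_abs_sub_le`), and dominated convergence concludes. -/

namespace MonotoneAverage

/-! ### Randomized signs -/

section Symmetrization

variable {Ω E : Type*} [MeasurableSpace Ω] {P : Measure Ω} [IsProbabilityMeasure P]
  [NormedAddCommGroup E] [NormedSpace ℝ E] [CompleteSpace E] [MeasurableSpace E] [BorelSpace E]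
  [SecondCountableTopology E]

/-- Subtracting an independent centred variable does not decrease the expected norm. -/
theorem integral_norm_le_integral_norm_sub {X Z : Ω → E} (hX : Measurable X) (hZ : Measurable Z)
    (hXi : Integrable X P) (hZi : Integrable Z P) (hXZ : IndepFun X Z P) (hZ0 : ∫ ω, Z ω ∂P = 0) :
    ∫ ω, ‖X ω‖ ∂P ≤ ∫ ω, ‖X ω - Z ω‖ ∂P := by
  have hprod := (indepFun_iff_map_prod_eq_prod_map_map hX.aemeasurable hZ.aemeasurable).1 hXZ
  have hXp : IsProbabilityMeasure (P.map X) := Measure.isProbabilityMeasure_map hX.aemeasurable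
  have hZp : IsProbabilityMeasure (P.map Z) := Measure.isProbabilityMeasure_map hZ.aemeasurable
  have hmeas : Measurable fun p : E × E => ‖p.1 - p.2‖ := by fun_prop
  have hXm : Integrable (fun x : E => x) (P.map X) :=
    (integrable_map_measure (by fun_prop) hX.aemeasurable).2 hXi
  have hZm : Integrable (fun x : E => x) (P.map Z) :=
    (integrable_map_measure (by fun_prop) hZ.aemeasurable).2 hZi
  have hint : Integrable (fun p : E × E => ‖p.1 - p.2‖) ((P.map X).prod (P.map Z)) := by
    rw [← hprod]
    exact (integrable_map_measure hmeas.aestronglyMeasurable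
      (hX.prodMk hZ).aemeasurable).2 (hXi.sub hZi).norm
  have h1 : ∫ ω, ‖X ω - Z ω‖ ∂P = ∫ x, ∫ z, ‖x - z‖ ∂(P.map Z) ∂(P.map X) := by
    rw [← integral_prod _ hint, ← hprod,
      integral_map (hX.prodMk hZ).aemeasurable hmeas.aestronglyMeasurable]
  have h2 : ∫ ω, ‖X ω‖ ∂P = ∫ x, ‖x‖ ∂(P.map X) := by
    rw [integral_map hX.aemeasurable (by fun_prop)]
  rw [h1, h2]
  refine integral_mono hXm.norm hint.integral_prod_left fun x => ?_
  -- Jensen's inequality in `Z` for each fixed value `x` of `X`.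
  have h3 : ∫ z, (x - z) ∂(P.map Z) = x := by
    rw [integral_sub (integrable_const _) hZm,
      integral_map hZ.aemeasurable (f := fun x : E => x) (by fun_prop), hZ0]
    simp
  calc ‖x‖ = ‖∫ z, (x - z) ∂(P.map Z)‖ := by rw [h3]
    _ ≤ ∫ z, ‖x - z‖ ∂(P.map Z) := norm_integral_le_integral_norm _

/-- Changing the signs of independent centred summands changes the expected norm of the sum by a
factor of at most two. -/
theorem integral_norm_sum_le_two_mul {ι : Type*} [Fintype ι] {Y : ι → Ω → E}
    (hY : ∀ i, Measurable (Y i)) (hYi : ∀ i, Integrable (Y i) P) (hind : iIndepFun Y P)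
    (hY0 : ∀ i, ∫ ω, Y i ω ∂P = 0) (ε : ι → ℤˣ) :
    ∫ ω, ‖∑ i, Y i ω‖ ∂P ≤ 2 * ∫ ω, ‖∑ i, ((ε i : ℤ) : ℝ) • Y i ω‖ ∂P := by
  classical
  set s : Finset ι := Finset.univ.filter fun i => ε i = 1 with hs
  set A : Ω → E := fun ω => ∑ i ∈ s, Y i ω with hA
  set B : Ω → E := fun ω => ∑ i ∈ sᶜ, Y i ω with hB
  have hAm : Measurable A := by fun_prop
  have hBm : Measurable B := by fun_prop
  have hAi : Integrable A P := integrable_finsetSum _ fun i _ => hYi i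
  have hBi : Integrable B P := integrable_finsetSum _ fun i _ => hYi i
  have hA0 : ∫ ω, A ω ∂P = 0 := by
    rw [hA, integral_finsetSum _ fun i _ => hYi i]
    exact Finset.sum_eq_zero fun i _ => hY0 i
  have hB0 : ∫ ω, B ω ∂P = 0 := by
    rw [hB, integral_finsetSum _ fun i _ => hYi i]
    exact Finset.sum_eq_zero fun i _ => hY0 i
  have hAB : IndepFun A B P := by
    have h := hind.indepFun_finset s sᶜ disjoint_compl_right hY
    have hφ : ∀ t : Finset ι, Measurable fun y : t → E => ∑ i, y i := fun t => by fun_prop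
    convert h.comp (hφ s) (hφ sᶜ) using 1
    · ext ω
      exact (Finset.sum_coe_sort s fun i => Y i ω).symm
    · ext ω
      exact (Finset.sum_coe_sort sᶜ fun i => Y i ω).symm
  have hsum : ∀ ω, ∑ i, Y i ω = A ω + B ω := fun ω => (Finset.sum_add_sum_compl s _).symm
  have hsgn : ∀ ω, ∑ i, ((ε i : ℤ) : ℝ) • Y i ω = A ω - B ω := fun ω => by
    rw [← Finset.sum_add_sum_compl s, sub_eq_add_neg, hA, hB, ← Finset.sum_neg_distrib]
    congr 1
    · refine Finset.sum_congr rfl fun i hi => ?_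
      simp [(Finset.mem_filter.1 hi).2]
    · refine Finset.sum_congr rfl fun i hi => ?_
      have : ε i = -1 := (Int.units_eq_one_or _).resolve_left fun h => by simp [hs, h] at hi
      simp [this]
  have h1 := integral_norm_le_integral_norm_sub hAm hBm hAi hBi hAB hB0
  have h2 := integral_norm_le_integral_norm_sub hBm hAm hBi hAi hAB.symm hA0
  simp_rw [norm_sub_rev (B _)] at h2
  simp_rw [hsum, hsgn]
  calc ∫ ω, ‖A ω + B ω‖ ∂P ≤ ∫ ω, (‖A ω‖ + ‖B ω‖) ∂P :=
        integral_mono (hAi.add hBi).norm (hAi.norm.add hBi.norm) fun ω => norm_add_le _ _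
    _ = ∫ ω, ‖A ω‖ ∂P + ∫ ω, ‖B ω‖ ∂P := integral_add hAi.norm hBi.norm
    _ ≤ 2 * ∫ ω, ‖A ω - B ω‖ ∂P := by linarith

/-- A pathwise bound on Rademacher averages bounds the expected norm of the sum. -/
theorem integral_norm_sum_le_of_sum_norm_le {ι : Type*} [Fintype ι] [DecidableEq ι]
    {Y : ι → Ω → E} (hY : ∀ i, Measurable (Y i)) (hYi : ∀ i, Integrable (Y i) P)
    (hind : iIndepFun Y P) (hY0 : ∀ i, ∫ ω, Y i ω ∂P = 0) {C : ℝ}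
    (hC : ∀ ω, ∑ ε : ι → ℤˣ, ‖∑ i, ((ε i : ℤ) : ℝ) • Y i ω‖ ≤ C * Fintype.card (ι → ℤˣ)) :
    ∫ ω, ‖∑ i, Y i ω‖ ∂P ≤ 2 * C := by
  have hN0 : (0 : ℝ) < Fintype.card (ι → ℤˣ) := by exact_mod_cast Fintype.card_pos
  generalize hN : (Fintype.card (ι → ℤˣ) : ℝ) = N at hC hN0
  have hYs : ∀ ε : ι → ℤˣ, Integrable (fun ω => ‖∑ i, ((ε i : ℤ) : ℝ) • Y i ω‖) P := fun ε =>
    (integrable_finsetSum _ fun i _ => (hYi i).smul ((ε i : ℤ) : ℝ)).norm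
  refine le_of_mul_le_mul_left ?_ hN0
  calc N * ∫ ω, ‖∑ i, Y i ω‖ ∂P = ∑ _ε : ι → ℤˣ, ∫ ω, ‖∑ i, Y i ω‖ ∂P := by
        rw [Finset.sum_const, Finset.card_univ, nsmul_eq_mul, hN]
    _ ≤ ∑ ε : ι → ℤˣ, 2 * ∫ ω, ‖∑ i, ((ε i : ℤ) : ℝ) • Y i ω‖ ∂P :=
        Finset.sum_le_sum fun ε _ => integral_norm_sum_le_two_mul hY hYi hind hY0 ε
    _ = 2 * ∫ ω, ∑ ε : ι → ℤˣ, ‖∑ i, ((ε i : ℤ) : ℝ) • Y i ω‖ ∂P := by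
        rw [← Finset.mul_sum, integral_finsetSum _ fun ε _ => hYs ε]
    _ ≤ 2 * ∫ _ω, C * N ∂P := by
        exact mul_le_mul_of_nonneg_left (integral_mono (integrable_finsetSum _ fun ε _ => hYs ε)
          (integrable_const _) hC) zero_le_two
    _ = N * (2 * C) := by
        rw [integral_const, probReal_univ, one_smul]
        ring

end Symmetrization

/-! ### A maximal inequality for Rademacher sums -/

section Rademacher

variable {ι : Type*}

/-- The sum of the signs `ε i` over `i ∈ s`. -/
def signSum (s : Finset ι) (ε : ι → ℤˣ) : ℝ := ∑ i ∈ s, ((ε i : ℤ) : ℝ)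

theorem signSum_congr {s : Finset ι} {ε ε' : ι → ℤˣ} (h : ∀ i ∈ s, ε i = ε' i) :
    signSum s ε = signSum s ε' :=
  Finset.sum_congr rfl fun i hi => by rw [h i hi]

theorem signSum_neg (s : Finset ι) (ε : ι → ℤˣ) : signSum s (-ε) = -signSum s ε := by
  simp [signSum]

variable [Fintype ι] [DecidableEq ι]

/-- Flipping the sign `ε i` shows that `ε i` is orthogonal to functions not depending on it. -/
theorem sum_mul_sign_eq_zero (i : ι) (g : (ι → ℤˣ) → ℝ)
    (hg : ∀ ε ε' : ι → ℤˣ, (∀ j ≠ i, ε j = ε' j) → g ε = g ε') :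
    ∑ ε : ι → ℤˣ, g ε * ((ε i : ℤ) : ℝ) = 0 := by
  have h := Equiv.sum_comp (Equiv.mulLeft (Pi.mulSingle i (-1 : ℤˣ)))
    fun ε : ι → ℤˣ => g ε * ((ε i : ℤ) : ℝ)
  have h' : ∀ ε : ι → ℤˣ, g (Pi.mulSingle i (-1 : ℤˣ) * ε)
      * ((((Pi.mulSingle i (-1 : ℤˣ) * ε : ι → ℤˣ) i : ℤˣ) : ℤ) : ℝ)
      = -(g ε * ((ε i : ℤ) : ℝ)) := fun ε => by
    rw [hg (Pi.mulSingle (M := fun _ : ι => ℤˣ) i (-1 : ℤˣ) * ε) ε fun j hj => by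
      rw [Pi.mul_apply, Pi.mulSingle_eq_of_ne hj, one_mul]]
    simp
  simp only [Equiv.coe_mulLeft, h', Finset.sum_neg_distrib] at h
  linarith

/-- Orthogonality of martingale increments: `g` depends only on signs outside `s`, and each sign in
`s` can be flipped. -/
theorem sum_mul_signSum_eq_zero (s : Finset ι) (g : (ι → ℤˣ) → ℝ)
    (hg : ∀ ε ε' : ι → ℤˣ, (∀ j ∉ s, ε j = ε' j) → g ε = g ε') :
    ∑ ε : ι → ℤˣ, g ε * signSum s ε = 0 := by
  simp_rw [signSum, Finset.mul_sum]
  rw [Finset.sum_comm]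
  exact Finset.sum_eq_zero fun i hi => sum_mul_sign_eq_zero i g fun ε ε' h =>
    hg ε ε' fun j hj => h j fun hji => hj (hji ▸ hi)

theorem sum_signSum_sq (s : Finset ι) :
    ∑ ε : ι → ℤˣ, signSum s ε ^ 2 = s.card * Fintype.card (ι → ℤˣ) := by
  induction s using Finset.induction_on with
  | empty => simp [signSum]
  | insert a s ha ih =>
    have h : ∀ ε : ι → ℤˣ, signSum (insert a s) ε ^ 2
        = 1 + 2 * (signSum s ε * ((ε a : ℤ) : ℝ)) + signSum s ε ^ 2 := fun ε => by
      have h1 : ((ε a : ℤ) : ℝ) ^ 2 = 1 := by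
        rcases Int.units_eq_one_or (ε a) with h | h <;> simp [h]
      simp only [signSum, Finset.sum_insert ha]
      linear_combination h1
    simp_rw [h, Finset.sum_add_distrib, ← Finset.mul_sum]
    rw [ih, sum_mul_sign_eq_zero a _ fun ε ε' h => signSum_congr fun j hj =>
      h j fun hja => ha (hja ▸ hj), Finset.card_insert_of_notMem ha]
    simp
    ring

/-- The running maximum of a sequence. -/
def runMax (S : ℕ → ℝ) : ℕ → ℝ
  | 0 => S 0
  | k + 1 => max (runMax S k) (S (k + 1))

theorem le_runMax (S : ℕ → ℝ) {j k : ℕ} (h : j ≤ k) : S j ≤ runMax S k := by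
  induction k, h using Nat.le_induction with
  | base => cases j <;> simp [runMax]
  | succ k _ ih => exact ih.trans (le_max_left _ _)

theorem runMax_congr {S S' : ℕ → ℝ} {k : ℕ} (h : ∀ j ≤ k, S j = S' j) :
    runMax S k = runMax S' k := by
  induction k with
  | zero => exact h 0 le_rfl
  | succ k ih => simp only [runMax, ih fun j hj => h j (by omega), h (k + 1) le_rfl]

/-- The pathwise form of Doob's `L²` maximal inequality. -/
theorem runMax_sq_le (S : ℕ → ℝ) (k : ℕ) :
    runMax S k ^ 2 ≤ 4 * S k ^ 2
      - 4 * ∑ j ∈ Finset.range k, runMax S j * (S (j + 1) - S j) := by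
  -- Doubling this bound and using `4MS ≤ M² + 4S²` absorbs one copy of `M²`. Unlike the target, it
  -- passes through the induction.
  suffices h : runMax S k ^ 2 ≤ 2 * runMax S k * S k
      - 2 * ∑ j ∈ Finset.range k, runMax S j * (S (j + 1) - S j) by
    nlinarith [sq_nonneg (runMax S k - 2 * S k)]
  induction k with
  | zero => simp [runMax]; nlinarith
  | succ k ih =>
    rw [Finset.sum_range_succ]
    simp only [runMax]
    rcases le_total (S (k + 1)) (runMax S k) with h | h
    · rw [max_eq_left h]
      linarith
    · rw [max_eq_right h]
      nlinarith [sq_nonneg (runMax S k - S (k + 1))]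

variable {A : ℕ → Finset ι}

/-- Summing the pathwise inequality over all signs removes the martingale transform: the maximum up
to `j` sees only signs in `A j`, the next increment only signs outside it. -/
theorem sum_runMax_sq_le (hA : Monotone A) (k : ℕ) :
    ∑ ε : ι → ℤˣ, runMax (fun j => signSum (A j) ε) k ^ 2
      ≤ 4 * (Fintype.card ι * Fintype.card (ι → ℤˣ)) := by
  have hI : ∑ ε : ι → ℤˣ, ∑ j ∈ Finset.range k, runMax (fun j => signSum (A j) ε) j
      * (signSum (A (j + 1)) ε - signSum (A j) ε) = 0 := by
    rw [Finset.sum_comm]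
    refine Finset.sum_eq_zero fun j _ => ?_
    have hsub : ∀ ε : ι → ℤˣ, signSum (A (j + 1)) ε - signSum (A j) ε
        = signSum (A (j + 1) \ A j) ε := fun ε => by
      rw [sub_eq_iff_eq_add]
      exact (Finset.sum_sdiff (hA j.le_succ)).symm
    simp_rw [hsub]
    refine sum_mul_signSum_eq_zero _ _ fun ε ε' h => runMax_congr fun l hl => signSum_congr
      fun i hi => h i ?_
    simp [hA hl hi]
  calc _ ≤ ∑ ε : ι → ℤˣ, (4 * signSum (A k) ε ^ 2
        - 4 * ∑ j ∈ Finset.range k, runMax (fun j => signSum (A j) ε) j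
          * (signSum (A (j + 1)) ε - signSum (A j) ε)) :=
        Finset.sum_le_sum fun ε _ => runMax_sq_le (fun j => signSum (A j) ε) k
    _ = 4 * ((A k).card * Fintype.card (ι → ℤˣ)) := by
        rw [Finset.sum_sub_distrib, ← Finset.mul_sum, ← Finset.mul_sum, hI, sum_signSum_sq]
        ring
    _ ≤ _ := by
        gcongr
        exact Finset.card_le_univ _

/-- Rademacher sums along a finite chain of index sets satisfy a maximal inequality. -/
theorem sum_norm_signSum_le {τ : Type*} [Fintype τ] [LinearOrder τ] {A : τ → Finset ι}
    (hA : Monotone A) :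
    ∑ ε : ι → ℤˣ, ‖fun v => signSum (A v) ε‖
      ≤ Real.sqrt (8 * Fintype.card ι) * Fintype.card (ι → ℤˣ) := by
  rcases isEmpty_or_nonempty τ with hτ | hτ
  · have : ∀ ε : ι → ℤˣ, ‖fun v => signSum (A v) ε‖ = 0 := fun ε => by
      rw [norm_eq_zero]; exact Subsingleton.elim _ _
    simp only [this, Finset.sum_const_zero]
    positivity
  have hpos : 0 < Fintype.card τ := Fintype.card_pos
  let e := Fintype.orderIsoFinOfCardEq τ rfl
  let k := Fintype.card τ - 1
  -- The increasing enumeration of `τ`, constant at the top element from `k` on.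
  let u : ℕ → τ := fun j => e ⟨min j k, by omega⟩
  have hu : Monotone u := fun a b hab => e.monotone (by
    simp only [Fin.mk_le_mk]; exact min_le_min_right k hab)
  have hue : ∀ v, ∃ j ≤ k, u j = v := fun v => by
    have hj : ((e.symm v : Fin _) : ℕ) ≤ k := by have := (e.symm v).2; omega
    refine ⟨e.symm v, hj, ?_⟩
    simp [u, min_eq_left hj]
  set M : (ι → ℤˣ) → ℝ := fun ε => runMax (fun j => signSum (A (u j)) ε) k with hM
  have hM2 : ∑ ε, M ε ^ 2 ≤ 4 * (Fintype.card ι * Fintype.card (ι → ℤˣ)) :=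
    sum_runMax_sq_le (hA.comp hu) k
  have hM2' : ∑ ε, M (-ε) ^ 2 ≤ 4 * (Fintype.card ι * Fintype.card (ι → ℤˣ)) := by
    exact (Equiv.sum_comp (Equiv.neg (ι → ℤˣ)) fun ε => M ε ^ 2).trans_le hM2
  -- `M (-ε)` controls the negative excursions; the two maxima contribute 4 each to the constant 8.
  have hnorm : ∀ ε : ι → ℤˣ, ‖fun v => signSum (A v) ε‖ ^ 2 ≤ M ε ^ 2 + M (-ε) ^ 2 := fun ε => by
    have h : ‖fun v => signSum (A v) ε‖ ≤ Real.sqrt (M ε ^ 2 + M (-ε) ^ 2) := by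
      refine (pi_norm_le_iff_of_nonneg (Real.sqrt_nonneg _)).2 fun v => Real.le_sqrt_of_sq_le ?_
      obtain ⟨j, hj, rfl⟩ := hue v
      have h1 : signSum (A (u j)) ε ≤ M ε := le_runMax (fun j => signSum (A (u j)) ε) hj
      have h2 : -signSum (A (u j)) ε ≤ M (-ε) := by
        rw [← signSum_neg]
        exact le_runMax (fun j => signSum (A (u j)) (-ε)) hj
      rw [Real.norm_eq_abs, sq_abs]
      rcases le_total 0 (signSum (A (u j)) ε) with h | h <;>
        nlinarith [sq_nonneg (M ε), sq_nonneg (M (-ε))]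
    calc _ ≤ Real.sqrt (M ε ^ 2 + M (-ε) ^ 2) ^ 2 := by gcongr
      _ = _ := Real.sq_sqrt (by positivity)
  -- Cauchy–Schwarz passes from the `L²` bound to `L¹`.
  have hcs := sq_sum_le_card_mul_sum_sq (s := Finset.univ)
    (f := fun ε : ι → ℤˣ => ‖fun v => signSum (A v) ε‖)
  rw [Finset.card_univ] at hcs
  have hsum : ∑ ε : ι → ℤˣ, ‖fun v => signSum (A v) ε‖ ^ 2
      ≤ 8 * (Fintype.card ι * Fintype.card (ι → ℤˣ)) := by
    calc _ ≤ ∑ ε, (M ε ^ 2 + M (-ε) ^ 2) := Finset.sum_le_sum fun ε _ => hnorm ε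
      _ ≤ _ := by rw [Finset.sum_add_distrib]; linarith
  refine abs_le_of_sq_le_sq' ?_ (by positivity) |>.2
  rw [mul_pow, Real.sq_sqrt (by positivity)]
  calc _ ≤ _ := hcs
    _ ≤ (Fintype.card (ι → ℤˣ) : ℝ) * (8 * (Fintype.card ι * Fintype.card (ι → ℤˣ))) := by gcongr
    _ = _ := by ring

/-- The layer cake formula for numbers in `[0, 1]`. -/
theorem integral_indicator_lt {x : ℝ} (hx : x ∈ Set.Icc (0 : ℝ) 1) :
    ∫ t in Set.Icc (0 : ℝ) 1, (if t < x then (1 : ℝ) else 0) = x := by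
  have h : (fun t : ℝ => if t < x then (1 : ℝ) else 0) = (Set.Iio x).indicator 1 := by
    ext t; simp [Set.indicator]
  rw [h, integral_indicator_one measurableSet_Iio, measureReal_restrict_apply measurableSet_Iio]
  have h2 : Set.Iio x ∩ Set.Icc 0 1 = Set.Ico 0 x := by
    ext t
    simp only [Set.mem_inter_iff, Set.mem_Iio, Set.mem_Icc, Set.mem_Ico]
    exact ⟨fun h => ⟨h.2.1, h.1⟩, fun h => ⟨h.2, h.1, h.2.le.trans hx.2⟩⟩
  rw [h2, Real.volume_real_Ico_of_le hx.1, sub_zero]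

/-- Rademacher averages of monotone functions with values in `[0, 1]`. -/
theorem sum_norm_sum_sign_smul_le {τ : Type*} [Fintype τ] [LinearOrder τ] {f : ι → τ → ℝ}
    (hf : ∀ i, Monotone (f i)) (hf01 : ∀ i v, f i v ∈ Set.Icc (0 : ℝ) 1) :
    ∑ ε : ι → ℤˣ, ‖∑ i, ((ε i : ℤ) : ℝ) • f i‖
      ≤ Real.sqrt (8 * Fintype.card ι) * Fintype.card (ι → ℤˣ) := by
  let A : ℝ → τ → Finset ι := fun t v => Finset.univ.filter fun i => t < f i v
  have hA : ∀ t, Monotone (A t) := fun t v w hvw i hi => by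
    simp only [A, Finset.mem_filter, Finset.mem_univ, true_and] at hi ⊢
    exact hi.trans_le (hf i hvw)
  have hsum : ∀ t v (ε : ι → ℤˣ), signSum (A t v) ε
      = ∑ i, ((ε i : ℤ) : ℝ) * (if t < f i v then (1 : ℝ) else 0) := fun t v ε => by
    simp [signSum, A, Finset.sum_filter]
  have hint1 : ∀ i v, Integrable (fun t : ℝ => if t < f i v then (1 : ℝ) else 0)
      (volume.restrict (Set.Icc 0 1)) := fun i v => by
    refine Integrable.of_bound (C := 1) (Measurable.aestronglyMeasurable ?_) (.of_forall ?_)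
    · exact Measurable.ite measurableSet_Iio measurable_const measurable_const
    · intro t; split_ifs <;> simp
  have hint : ∀ ε : ι → ℤˣ, Integrable (fun t => fun v => signSum (A t v) ε)
      (volume.restrict (Set.Icc 0 1)) := fun ε => by
    refine Integrable.of_eval fun v => ?_
    simp_rw [hsum]
    exact integrable_finsetSum _ fun i _ => (hint1 i v).const_mul _
  -- The layer cake as an integral of vectors in `τ → ℝ`, so that the sup norm can move inside.
  have hrepr : ∀ ε : ι → ℤˣ, ∑ i, ((ε i : ℤ) : ℝ) • f i
      = ∫ t in Set.Icc (0 : ℝ) 1, fun v => signSum (A t v) ε := fun ε => by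
    ext v
    rw [eval_integral fun v => (hint ε).eval v]
    simp_rw [hsum]
    rw [integral_finsetSum _ fun i _ => (hint1 i v).const_mul _]
    simp_rw [integral_const_mul, integral_indicator_lt (hf01 _ v)]
    simp
  calc _ ≤ ∑ ε : ι → ℤˣ, ∫ t in Set.Icc (0 : ℝ) 1, ‖fun v => signSum (A t v) ε‖ :=
        Finset.sum_le_sum fun ε _ => by rw [hrepr]; exact norm_integral_le_integral_norm _
    _ = ∫ t in Set.Icc (0 : ℝ) 1, ∑ ε : ι → ℤˣ, ‖fun v => signSum (A t v) ε‖ :=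
        (integral_finsetSum _ fun ε _ => (hint ε).norm).symm
    _ ≤ ∫ _t in Set.Icc (0 : ℝ) 1,
          Real.sqrt (8 * Fintype.card ι) * Fintype.card (ι → ℤˣ) :=
        integral_mono (integrable_finsetSum _ fun ε _ => (hint ε).norm) (integrable_const _)
          fun t => sum_norm_signSum_le (hA t)
    _ = _ := by simp

/-- Rademacher averages of differences of monotone functions with values in `[0, 1]`. -/
theorem sum_norm_sum_sign_smul_sub_le {τ : Type*} [Fintype τ] [LinearOrder τ] {f g : ι → τ → ℝ}
    (hf : ∀ i, Monotone (f i)) (hf01 : ∀ i v, f i v ∈ Set.Icc (0 : ℝ) 1)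
    (hg : ∀ i, Monotone (g i)) (hg01 : ∀ i v, g i v ∈ Set.Icc (0 : ℝ) 1) :
    ∑ ε : ι → ℤˣ, ‖∑ i, ((ε i : ℤ) : ℝ) • (f i - g i)‖
      ≤ 2 * Real.sqrt (8 * Fintype.card ι) * Fintype.card (ι → ℤˣ) := by
  calc _ ≤ ∑ ε : ι → ℤˣ, (‖∑ i, ((ε i : ℤ) : ℝ) • f i‖ + ‖∑ i, ((ε i : ℤ) : ℝ) • g i‖) := by
        refine Finset.sum_le_sum fun ε _ => ?_
        simp_rw [smul_sub, Finset.sum_sub_distrib]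
        exact norm_sub_le _ _
    _ ≤ _ := by
        rw [Finset.sum_add_distrib, mul_assoc, two_mul]
        exact add_le_add (sum_norm_sum_sign_smul_le hf hf01) (sum_norm_sum_sign_smul_le hg hg01)

end Rademacher

/-! ### Averages of independent random monotone functions -/

/-- For a monotone function `m` there is a countable set of points that determines the uniform
distance of `m` to any other monotone function. -/
theorem exists_seq_forall_abs_sub_le {m : ℝ → ℝ} (hm : Monotone m) :
    ∃ q : ℕ → ℝ, ∀ G : ℝ → ℝ, Monotone G → ∀ b, (∀ j, |G (q j) - m (q j)| ≤ b) →
      ∀ v, |G v - m v| ≤ b := by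
  -- Where `m` is continuous, nearby rationals on both sides squeeze `G v`; the other points are
  -- countably many and are included. Continuity of `G` plays no role, so the same `q` serves every
  -- `ω`.
  have hc : (Set.range ((↑) : ℚ → ℝ) ∪ {v | ¬ContinuousAt m v}).Countable :=
    (Set.countable_range _).union hm.countable_not_continuousAt
  obtain ⟨q, hq⟩ := hc.exists_eq_range ⟨0, .inl ⟨0, by simp⟩⟩
  refine ⟨q, fun G hG b hb v => ?_⟩
  have hb' : ∀ w ∈ Set.range ((↑) : ℚ → ℝ) ∪ {v | ¬ContinuousAt m v}, |G w - m w| ≤ b := by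
    rw [hq]; rintro _ ⟨j, rfl⟩; exact hb j
  by_cases hv : ContinuousAt m v
  · refine le_of_forall_pos_le_add fun δ hδ => ?_
    obtain ⟨η, hη, hball⟩ := Metric.continuousAt_iff.1 hv δ hδ
    obtain ⟨r, hr1, hr2⟩ := exists_rat_btwn (show v < v + η by linarith)
    obtain ⟨s, hs1, hs2⟩ := exists_rat_btwn (show v - η < v by linarith)
    have hr : dist (m r) (m v) < δ := hball (by rw [Real.dist_eq, abs_lt]; constructor <;> linarith)
    have hs : dist (m s) (m v) < δ := hball (by rw [Real.dist_eq, abs_lt]; constructor <;> linarith)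
    rw [Real.dist_eq, abs_lt] at hr hs
    have h1 := abs_le.1 (hb' r (.inl ⟨r, rfl⟩))
    have h2 := abs_le.1 (hb' s (.inl ⟨s, rfl⟩))
    rw [abs_le]
    constructor <;> linarith [hG hr1.le, hG hs2.le]
  · exact hb' v (.inr hv)

theorem monotone_avg {Ω : Type*} {n : ℕ} {F : Fin n → Ω → ℝ → ℝ}
    (hmono : ∀ i ω, Monotone (F i ω)) (ω : Ω) : Monotone (avg F ω) :=
  fun v w hvw => mul_le_mul_of_nonneg_left (Finset.sum_le_sum fun i _ => hmono i ω hvw)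
    (by positivity)

theorem avg_mem_Icc {Ω : Type*} {n : ℕ} {F : Fin n → Ω → ℝ → ℝ}
    (h01 : ∀ i ω v, F i ω v ∈ Set.Icc (0 : ℝ) 1) (ω : Ω) (v : ℝ) :
    avg F ω v ∈ Set.Icc (0 : ℝ) 1 := by
  refine ⟨mul_nonneg (by positivity) (Finset.sum_nonneg fun i _ => (h01 i ω v).1), ?_⟩
  have h : ∑ i, F i ω v ≤ n := by
    calc _ ≤ ∑ _i : Fin n, (1 : ℝ) := Finset.sum_le_sum fun i _ => (h01 i ω v).2
      _ = n := by simp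
  calc avg F ω v ≤ 1 / n * n := mul_le_mul_of_nonneg_left h (by positivity)
    _ ≤ 1 := by rw [one_div]; exact inv_mul_le_one

theorem monotone_mean {Ω : Type*} [MeasurableSpace Ω] {P : Measure Ω} {τ : Type*} [Preorder τ] {G : Ω → τ → ℝ} (hG : ∀ ω, Monotone (G ω))
    (hGi : ∀ v, Integrable (fun ω => G ω v) P) : Monotone fun v => ∫ ω, G ω v ∂P :=
  fun v w hvw => integral_mono (hGi v) (hGi w) fun ω => hG ω hvw

section Average

variable {Ω : Type*} [MeasurableSpace Ω] {P : Measure Ω} [IsProbabilityMeasure P]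

theorem integrable_of_mem_Icc {g : Ω → ℝ} (hg : Measurable g)
    (h : ∀ ω, g ω ∈ Set.Icc (0 : ℝ) 1) : Integrable g P :=
  Integrable.of_bound hg.aestronglyMeasurable 1 (.of_forall fun ω => by
    rw [Real.norm_eq_abs, abs_le]; exact ⟨by linarith [(h ω).1], (h ω).2⟩)

theorem mean_mem_Icc {g : Ω → ℝ} (hg : Measurable g) (h : ∀ ω, g ω ∈ Set.Icc (0 : ℝ) 1) :
    ∫ ω, g ω ∂P ∈ Set.Icc (0 : ℝ) 1 := by
  refine ⟨integral_nonneg fun ω => (h ω).1, ?_⟩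
  calc ∫ ω, g ω ∂P ≤ ∫ _ω, (1 : ℝ) ∂P :=
        integral_mono (integrable_of_mem_Icc hg h) (integrable_const _) fun ω => (h ω).2
    _ = 1 := by simp

/-- The uniform bound on finitely many points. -/
theorem integral_norm_sum_sub_mean_le {ι τ : Type*} [Fintype ι] [Fintype τ] [LinearOrder τ]
    {F : ι → Ω → τ → ℝ} (hF : ∀ i, Measurable (F i)) (hmono : ∀ i ω, Monotone (F i ω))
    (h01 : ∀ i ω v, F i ω v ∈ Set.Icc (0 : ℝ) 1) (hind : iIndepFun F P) :
    ∫ ω, ‖∑ i, (F i ω - fun v => ∫ ω', F i ω' v ∂P)‖ ∂P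
      ≤ 4 * Real.sqrt (8 * Fintype.card ι) := by
  classical
  set m : ι → τ → ℝ := fun i v => ∫ ω, F i ω v ∂P with hm
  have hFv : ∀ i v, Measurable fun ω => F i ω v := fun i v => (measurable_pi_apply v).comp (hF i)
  have hFvi : ∀ i v, Integrable (fun ω => F i ω v) P := fun i v =>
    integrable_of_mem_Icc (hFv i v) fun ω => h01 i ω v
  have hFi : ∀ i, Integrable (F i) P := fun i => Integrable.of_eval (hFvi i)
  have hmint : ∀ i, ∫ ω, F i ω ∂P = m i := fun i => by
    ext v; exact eval_integral (hFvi i) v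
  set Y : ι → Ω → τ → ℝ := fun i ω => F i ω - m i with hY
  have hYm : ∀ i, Measurable (Y i) := fun i => (hF i).sub_const _
  have hYi : ∀ i, Integrable (Y i) P := fun i => (hFi i).sub (integrable_const _)
  have hY0 : ∀ i, ∫ ω, Y i ω ∂P = 0 := fun i => by
    simp only [hY]
    rw [integral_sub (hFi i) (integrable_const _), hmint]
    simp
  have hYind : iIndepFun Y P :=
    hind.comp (fun i (y : τ → ℝ) => y - m i) fun i => measurable_id.sub_const _
  -- The factor 4 is 2 from the signs times 2 from bounding `F i ω` and `m i` separately.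
  have h := integral_norm_sum_le_of_sum_norm_le hYm hYi hYind hY0 fun ω =>
    sum_norm_sum_sign_smul_sub_le (fun i => hmono i ω) (fun i => h01 i ω)
      (fun i => monotone_mean (hmono i) (hFvi i))
      fun i v => mean_mem_Icc (hFv i v) fun ω => h01 i ω v
  linarith

variable {n : ℕ} {F : Fin n → Ω → ℝ → ℝ}

theorem measurable_avg (hF : ∀ i, Measurable (F i)) (v : ℝ) : Measurable fun ω => avg F ω v :=
  (Finset.measurable_sum _ fun i _ => (measurable_pi_apply v).comp (hF i)).const_mul _

theorem avg_sub_mean_eq (hF : ∀ i, Measurable (F i))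
    (h01 : ∀ i ω v, F i ω v ∈ Set.Icc (0 : ℝ) 1) (ω : Ω) (v : ℝ) :
    avg F ω v - mean P (avg F) v = (1 / (n : ℝ)) * ∑ i, (F i ω v - ∫ ω', F i ω' v ∂P) := by
  simp only [avg, mean]
  have hi : ∀ i, Integrable (fun ω => F i ω v) P := fun i => integrable_of_mem_Icc
    ((measurable_pi_apply v).comp (hF i)) fun ω => h01 i ω v
  rw [integral_const_mul, integral_finsetSum _ fun i _ => hi i, Finset.sum_sub_distrib, mul_sub]

theorem integral_norm_restrict_avg_sub_mean_le (hn : 0 < n) (hF : ∀ i, Measurable (F i))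
    (hmono : ∀ i ω, Monotone (F i ω)) (h01 : ∀ i ω v, F i ω v ∈ Set.Icc (0 : ℝ) 1)
    (hind : iIndepFun F P) (T : Finset ℝ) :
    ∫ ω, ‖fun v : T => avg F ω v - mean P (avg F) v‖ ∂P
      ≤ 4 * Real.sqrt 8 * (n : ℝ) ^ (-(1 / 2) : ℝ) := by
  have hn' : (0 : ℝ) < n := by exact_mod_cast hn
  have hres : Measurable fun (f : ℝ → ℝ) (v : T) => f v := by fun_prop
  have h := integral_norm_sum_sub_mean_le (P := P) (F := fun i ω (v : T) => F i ω v)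
    (fun i => hres.comp (hF i)) (fun i ω v w hvw => hmono i ω hvw) (fun i ω v => h01 i ω v)
    (hind.comp _ fun _ => hres)
  have heq : ∀ ω, ‖fun v : T => avg F ω v - mean P (avg F) v‖
      = 1 / n * ‖∑ i, ((fun v : T => F i ω v) - fun v : T => ∫ ω', F i ω' v ∂P)‖ := fun ω => by
    rw [← abs_of_nonneg (show (0 : ℝ) ≤ 1 / n by positivity), ← Real.norm_eq_abs, ← norm_smul]
    congr 1
    ext v
    rw [avg_sub_mean_eq hF h01]
    simp
  simp_rw [heq]
  rw [integral_const_mul]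
  calc _ ≤ 1 / (n : ℝ) * (4 * Real.sqrt (8 * Fintype.card (Fin n))) := by gcongr
    _ = _ := by
      rw [Fintype.card_fin, Real.sqrt_mul (by norm_num), Real.rpow_neg hn'.le,
        ← Real.sqrt_eq_rpow]
      have hs := Real.sqrt_pos.2 hn'
      have := Real.mul_self_sqrt hn'.le
      field_simp
      nlinarith

end Average

end MonotoneAverage

/-- Random functions are measurable maps into `ℝ → ℝ` with the product (cylinder) σ-algebra, and
independence is with respect to that σ-algebra. Since `C` is chosen first, it depends neither on
`n` nor on the distributions. -/
theorem mainTheorem12 :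
    ∃ C : ℝ, ∀ (n : ℕ), 0 < n →
      ∀ (Ω : Type*) [MeasurableSpace Ω] (P : Measure Ω) [IsProbabilityMeasure P]
        (F : Fin n → Ω → ℝ → ℝ),
        (∀ i, Measurable (F i)) →
        (∀ i ω, Monotone (F i ω)) →
        (∀ i ω v, F i ω v ∈ Set.Icc (0 : ℝ) 1) →
        iIndepFun F P →
        Integrable (fun ω => MonotoneAverage.supNorm
          (fun v => MonotoneAverage.avg F ω v
            - MonotoneAverage.mean P (MonotoneAverage.avg F) v)) P ∧
        ∫ ω, MonotoneAverage.supNorm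
          (fun v => MonotoneAverage.avg F ω v
            - MonotoneAverage.mean P (MonotoneAverage.avg F) v) ∂P
          ≤ C * (n : ℝ) ^ (-(1 / 2) : ℝ) := by
  refine ⟨4 * Real.sqrt 8, fun n hn Ω _ P _ F hF hmono h01 hind => ?_⟩
  set D : Ω → ℝ → ℝ := fun ω v =>
    MonotoneAverage.avg F ω v - MonotoneAverage.mean P (MonotoneAverage.avg F) v with hD
  have hA01 := MonotoneAverage.avg_mem_Icc h01
  have hAm := MonotoneAverage.measurable_avg hF
  obtain ⟨q, hq⟩ := MonotoneAverage.exists_seq_forall_abs_sub_le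
    (MonotoneAverage.monotone_mean (P := P) (MonotoneAverage.monotone_avg hmono) fun v =>
      MonotoneAverage.integrable_of_mem_Icc (hAm v) fun ω => hA01 ω v)
  have hD1 : ∀ ω v, |D ω v| ≤ 1 := fun ω v => by
    have h1 := hA01 ω v
    have h2 : MonotoneAverage.mean P (MonotoneAverage.avg F) v ∈ Set.Icc (0 : ℝ) 1 :=
      MonotoneAverage.mean_mem_Icc (hAm v) fun ω => hA01 ω v
    rw [abs_le]
    constructor <;> simp only [hD] <;> linarith [h1.1, h1.2, h2.1, h2.2]
  have hbdd : ∀ ω, BddAbove (Set.range fun v => |D ω v|) := fun ω =>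
    ⟨1, by rintro _ ⟨v, rfl⟩; exact hD1 ω v⟩
  set T : ℕ → Finset ℝ := fun N => (Finset.range (N + 1)).image q with hT
  set g : ℕ → Ω → ℝ := fun N ω => ‖fun v : T N => D ω v‖ with hg
  have hgle : ∀ N ω b, 0 ≤ b → (g N ω ≤ b ↔ ∀ v ∈ T N, |D ω v| ≤ b) := fun N ω b hb => by
    simp [hg, pi_norm_le_iff_of_nonneg hb]
  have hgmem : ∀ N ω, ∀ v ∈ T N, |D ω v| ≤ g N ω := fun N ω =>
    (hgle N ω _ (norm_nonneg _)).1 le_rfl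
  have hgmono : ∀ ω, Monotone fun N => g N ω := fun ω N N' h =>
    (hgle N ω _ (norm_nonneg _)).2 fun v hv => hgmem N' ω v
      (Finset.image_subset_image (Finset.range_mono (by omega)) hv)
  -- The uncountable supremum is a limit of finite maxima, which yields both its measurability and
  -- the passage to the limit in the bound.
  have hlub : ∀ ω, IsLUB (Set.range fun N => g N ω) (MonotoneAverage.supNorm (D ω)) := fun ω => by
    constructor
    · rintro _ ⟨N, rfl⟩
      exact (hgle N ω _ (Real.iSup_nonneg fun v => abs_nonneg _)).2 fun v _ =>
        le_ciSup (hbdd ω) v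
    · intro b hb
      refine ciSup_le fun v => hq _ (MonotoneAverage.monotone_avg hmono ω) b (fun j => ?_) v
      exact (hgmem j ω (q j) (Finset.mem_image_of_mem q (Finset.self_mem_range_succ j))).trans
        (hb ⟨j, rfl⟩)
  have hlim : ∀ ω, Filter.Tendsto (fun N => g N ω) Filter.atTop
      (nhds (MonotoneAverage.supNorm (D ω))) := fun ω => tendsto_atTop_isLUB (hgmono ω) (hlub ω)
  have hgmeas : ∀ N, Measurable (g N) := fun N =>
    (measurable_pi_lambda _ fun v : T N => (hAm v).sub_const _).norm
  have hmeas : Measurable fun ω => MonotoneAverage.supNorm (D ω) :=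
    measurable_of_tendsto_metrizable hgmeas (tendsto_pi_nhds.2 hlim)
  refine ⟨Integrable.of_bound hmeas.aestronglyMeasurable 1 (.of_forall fun ω => ?_), ?_⟩
  · have h0 : 0 ≤ MonotoneAverage.supNorm (D ω) := Real.iSup_nonneg fun v => abs_nonneg _
    exact (Real.norm_of_nonneg h0).trans_le (ciSup_le (hD1 ω))
  · refine le_of_tendsto (tendsto_integral_of_dominated_convergence (fun _ => 1)
      (fun N => (hgmeas N).aestronglyMeasurable) (integrable_const _)
      (fun N => .of_forall fun ω => ?_) (.of_forall hlim)) (.of_forall fun N => ?_)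
    · rw [Real.norm_of_nonneg (norm_nonneg _)]
      exact (hgle N ω 1 zero_le_one).2 fun v _ => hD1 ω v
    · exact MonotoneAverage.integral_norm_restrict_avg_sub_mean_le hn hF hmono h01 hind (T N)
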